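/- Theorem 2.1 (Weighted LDP). Let $X_1,X_2,\dots$ be i.i.d. real random variables with law $\gamma$ on a probability space $(\Omega,\mathcal F,\mathbb P)$, write $X^{(n)}=(X_1,\dots,X_n)$, and let $\Lambda(t)=\log\mathbb E[e^{tX_1}]\in(-\infty,\infty]$ for $t\in\mathbb R$. Let $\mathbb N=\{1,2,\dots\}$, let $\mathbb S^{n-1}$ be the Euclidean unit sphere of $\mathbb R^n$, let $\mathbb S=\prod_{n\in\mathbb N}\mathbb S^{n-1}$, and let $\nu$ be the standard Gaussian measure on $\mathbb R$. Assume: (H1) $\sigma$ is a Borel probability measure on $\mathbb S$ such that, for every $n\in\mathbb N$, its image under the coordinate map $\theta=(\theta^{(1)},\theta^{(2)},\dots)\mapsto\theta^{(n)}$ is the uniform (rotation invariant) probability measure on $\mathbb S^{n-1}$; (H2) $\int_{\mathbb R}|\Lambda(tu)|^4\,\nu(du)<\infty$ for all $t\in\mathbb R$. For $\theta\in\mathbb S$ put $W_\theta^{(n)}=n^{-1/2}\langle X^{(n)},\theta^{(n)}\rangle$, where $\langle\cdot,\cdot\rangle$ is the Euclidean inner product on $\mathbb R^n$, and put $$\Psi(t)=\int_{\mathbb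 R}\Lambda(tu)\,\nu(du)\quad(t\in\mathbb R),\qquad \Psi^*(w)=\sup_{t\in\mathbb R}\{tw-\Psi(t)\}\quad(w\in\mathbb R).$$ Then, for $\sigma$-almost every $\theta\in\mathbb S$, the sequence $(W_\theta^{(n)})_{n\in\mathbb N}$ satisfies a large deviation principle with the convex good rate function $\Psi^*$ (the same for all such $\theta$). That is, $\Psi^*:\mathbb R\to[0,\infty]$ is convex and lower semicontinuous, its level sets $\{\Psi^*\le c\}$, $c\in\mathbb R$, are compact, and for every Borel set $\Gamma\subset\mathbb R$ with interior $\Gamma^\circ$ and closure $\bar\Gamma$, $$-\inf_{x\in\Gamma^\circ}\Psi^*(x)\le\liminf_{n\to\infty}\tfrac1n\log\mathbb P(W_\theta^{(n)}\in\Gamma^\circ)\le\limsup_{n\to\infty}\tfrac1n\log\mathbb P(W_\theta^{(n)}\in\bar\Gamma)\le-\inf_{x\in\bar\Gamma}\Psi^*(x),$$ with the conventions $\log 0=-\infty$ and $\inf\emptyset=+\infty$. -/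

import Mathlib

open MeasureTheory ProbabilityTheory Filter

noncomputable section

/-! Sequences `(·)ₙ` with `n = 1, 2, 3, …` are indexed by `ℕ+`. -/

/-- The unit sphere `S^{n-1}` of the Euclidean space `ℝⁿ`. -/
abbrev UnitSphere (n : ℕ+) : Type :=
  Metric.sphere (0 : EuclideanSpace ℝ (Fin (n : ℕ))) 1

/-- `𝕊 = ∏ₙ S^{n-1}`, the space of sequences of directions (its Borel sigma-algebra is the
product sigma-algebra, as the product is countable and the factors are second countable). -/
abbrev Directions : Type := ∀ n : ℕ+, UnitSphere n

/-- The uniform (rotation invariant) probability measure `σ_{n-1}` on `S^{n-1}`: the surface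
measure divided by its total mass. -/
def uniformSphere (n : ℕ+) : Measure (UnitSphere n) :=
  ((volume : Measure (EuclideanSpace ℝ (Fin (n : ℕ)))).toSphere Set.univ)⁻¹ •
    (volume : Measure (EuclideanSpace ℝ (Fin (n : ℕ)))).toSphere

/-- The logarithmic moment generating function `Λ(t) = log ∫ e^{tx} γ(dx)`, with values in the
extended reals (it is `⊤` where the exponential moment is infinite). -/
def logMgf (γ : Measure ℝ) (t : ℝ) : EReal :=
  ENNReal.log (∫⁻ x, ENNReal.ofReal (Real.exp (t * x)) ∂γ)

/-- The integrability condition `∫ |Λ(tu)|⁴ ν(du) < ∞` for all real `t`, where `ν` is the standard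
Gaussian measure. The integrand takes values in `[0, ∞]`, so that the condition forces `Λ` to be
finite almost everywhere (hence, by convexity, everywhere). -/
def LogMgfFourthMoment (γ : Measure ℝ) : Prop :=
  ∀ t : ℝ, ∫⁻ u, (logMgf γ (t * u)).abs ^ 4 ∂(gaussianReal 0 1) < ⊤

/-- `Ψ(t) = ∫ Λ(tu) ν(du)`, for `Λ` finite and `Λ(t ·)` integrable with respect to the standard
Gaussian measure `ν` (both follow from `LogMgfFourthMoment`). -/
def gaussianLogMgf (γ : Measure ℝ) (t : ℝ) : ℝ :=
  ∫ u, (logMgf γ (t * u)).toReal ∂(gaussianReal 0 1)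

/-- The Legendre transform `f*(w) = sup_t (t w - f(t))`, with values in the extended reals. -/
def legendre (f : ℝ → ℝ) (w : ℝ) : EReal :=
  ⨆ t : ℝ, ((t * w - f t : ℝ) : EReal)

/-- The weighted mean `W_θ⁽ⁿ⁾ = n^{-1/2} ⟨X⁽ⁿ⁾, θ⁽ⁿ⁾⟩`, where `X⁽ⁿ⁾` consists of the first `n` terms
of the sequence `X`. -/
def weightedMean {Ω : Type*} (X : ℕ → Ω → ℝ) (θ : Directions) (n : ℕ+) (ω : Ω) : ℝ :=
  (√((n : ℕ) : ℝ))⁻¹ *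
    inner ℝ (WithLp.toLp 2 (fun i : Fin (n : ℕ) => X i ω)) (θ n : EuclideanSpace ℝ (Fin (n : ℕ)))

/-- The exponential rate `(1/n) log μₙ(A)`, which is `⊥` if `μₙ(A) = 0`. -/
def expRate (μ : ℕ+ → Measure ℝ) (A : Set ℝ) (n : ℕ+) : EReal :=
  ((((n : ℕ) : ℝ)⁻¹ : ℝ) : EReal) * ENNReal.log (μ n A)

/-- The sequence of measures `(μₙ)` satisfies a large deviation principle with the rate function
`I : ℝ → [0, ∞]`. -/
structure SatisfiesLDP (μ : ℕ+ → Measure ℝ) (I : ℝ → EReal) : Prop where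
  nonneg : ∀ x, 0 ≤ I x
  lowerSemicontinuous : LowerSemicontinuous I
  lower_bound : ∀ Γ : Set ℝ, MeasurableSet Γ →
    -(⨅ x ∈ interior Γ, I x) ≤ liminf (expRate μ (interior Γ)) atTop
  liminf_le_limsup : ∀ Γ : Set ℝ, MeasurableSet Γ →
    liminf (expRate μ (interior Γ)) atTop ≤ limsup (expRate μ (closure Γ)) atTop
  upper_bound : ∀ Γ : Set ℝ, MeasurableSet Γ →
    limsup (expRate μ (closure Γ)) atTop ≤ -(⨅ x ∈ closure Γ, I x)

/-- A rate function is good if its level sets are compact. -/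
def HasCompactLevelSets (I : ℝ → EReal) : Prop :=
  ∀ c : ℝ, IsCompact {x : ℝ | I x ≤ (c : EReal)}

/-- An extended-real-valued function is convex if its epigraph is. -/
def EpigraphConvex (I : ℝ → EReal) : Prop :=
  Convex ℝ {p : ℝ × ℝ | I p.1 ≤ (p.2 : EReal)}

end

/-!
The theorem is the Gärtner–Ellis theorem applied to the laws of the weighted means, for every direction
sequence `θ` along which their scaled cumulant generating functions converge; the point is that almost
every `θ` has this property.

By independence, `n⁻¹ log E[exp (n t W_θ⁽ⁿ⁾)] = n⁻¹ ∑ᵢ Λ(t √n θᵢ⁽ⁿ⁾)`, where `Λ = cgf id γ` is finite and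
convex on the whole line (`LogMgfFourthMoment.integrable_exp`, `logMgf_eq_cgf`). A uniform direction is
`Z / ‖Z‖` for a standard Gaussian vector `Z` (`uniformSphere_preimage_val`), so this is the convex
function `s ↦ n⁻¹ ∑ᵢ Λ(s Zᵢ)` evaluated at `s = t √n / ‖Z‖`. Fourth moments make the deviations of
`n⁻¹ ∑ᵢ Λ(s Zᵢ)` from `Ψ(s)` and of `‖Z‖² / n` from `1` summable in `n`
(`exists_measure_pi_abs_mean_sub_ge_le`), and a convex function close to the continuous `Ψ` at
finitely many rational points is close to it in between (`exists_forall_convexOn_abs_sub_lt`). Hence the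
deviations along the sphere are summable as well, and Borel–Cantelli, which ignores the joint law of
the directions, gives almost sure convergence to `Ψ(t)` for all rational `t`; the same stability lemma
extends it to all real `t` (`ae_forall_tendsto_directionalMean`).

The limit `Ψ` is convex, and differentiable by dominated convergence, as convexity of `Λ` bounds its
slopes by integrable difference quotients (`differentiable_integral_dilation`). On the line a direct
proof of Gärtner–Ellis suffices (`satisfiesLDP_legendre`). A closed set that misses `Ψ'(0)` lies in two
half-lines, to which Chernoff's bound applies. For an open set, exponential tilting gives the lower
bound near each slope `Ψ'(η)`, and by Darboux's theorem the slopes approximate from the side of `Ψ'(0)`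
every point at which `Ψ*` is finite, with no larger rate.
-/

open scoped Topology

/-! ### Legendre transforms -/

theorem le_legendre (f : ℝ → ℝ) (t w : ℝ) : ((t * w - f t : ℝ) : EReal) ≤ legendre f w :=
  le_iSup (fun t : ℝ => ((t * w - f t : ℝ) : EReal)) t

theorem legendre_le_coe_iff {f : ℝ → ℝ} {w c : ℝ} :
    legendre f w ≤ (c : EReal) ↔ ∀ t, t * w - f t ≤ c := by
  simp only [legendre, iSup_le_iff, EReal.coe_le_coe_iff]

theorem legendre_nonneg {f : ℝ → ℝ} (h0 : f 0 = 0) (w : ℝ) : 0 ≤ legendre f w := by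
  simpa [h0] using le_legendre f 0 w

theorem lowerSemicontinuous_legendre (f : ℝ → ℝ) : LowerSemicontinuous (legendre f) := by
  refine lowerSemicontinuous_iSup fun t => Continuous.lowerSemicontinuous ?_
  exact continuous_coe_real_ereal.comp (by fun_prop)

theorem hasCompactLevelSets_legendre (f : ℝ → ℝ) : HasCompactLevelSets (legendre f) := by
  intro c
  have hclosed : IsClosed {x : ℝ | legendre f x ≤ (c : EReal)} :=
    (lowerSemicontinuous_legendre f).isClosed_preimage (c : EReal)
  refine (isCompact_Icc (a := -(c + f (-1))) (b := c + f 1)).of_isClosed_subset hclosed ?_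
  intro x hx
  have h := legendre_le_coe_iff.1 hx
  constructor
  · linarith [h (-1)]
  · linarith [h 1]

theorem epigraphConvex_legendre (f : ℝ → ℝ) : EpigraphConvex (legendre f) := by
  rintro ⟨x, r⟩ hx ⟨y, s⟩ hy a b ha hb hab
  simp only [Set.mem_ofPred_eq, legendre_le_coe_iff, Prod.smul_mk, Prod.mk_add_mk, smul_eq_mul]
    at hx hy ⊢
  intro t
  have h1 := mul_le_mul_of_nonneg_left (hx t) ha
  have h2 := mul_le_mul_of_nonneg_left (hy t) hb
  have h3 : f t = a * f t + b * f t := by rw [← add_mul, hab, one_mul]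
  linarith

/-- If the Legendre transform is finite at `x`, every point from `f'(0)` up to, but excluding, `x` is a
slope of `f`: by Darboux's theorem a missing slope `y` would give `f t ≤ f 0 + y t` for `t ≥ 0`. -/
theorem exists_deriv_eq_of_legendre_le {f : ℝ → ℝ} (hd : Differentiable ℝ f) {x y c : ℝ}
    (hm : deriv f 0 ≤ y) (hyx : y < x) (hc : legendre f x ≤ (c : EReal)) :
    ∃ η, 0 ≤ η ∧ deriv f η = y := by
  by_contra! hne
  have hlt : ∀ t, 0 ≤ t → deriv f t < y := by
    intro t ht
    by_contra! hle
    have hoc : Set.OrdConnected (deriv f '' Set.Ici 0) :=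
      Set.ordConnected_Ici.image_hasDerivWithinAt
        fun t _ => (hd t).hasDerivAt.hasDerivWithinAt
    obtain ⟨η, hη, h⟩ := hoc.out ⟨0, Set.self_mem_Ici, rfl⟩ ⟨t, ht, rfl⟩ ⟨hm, hle⟩
    exact hne η hη h
  have hgrow : ∀ t, 0 ≤ t → f t ≤ f 0 + y * t := by
    intro t ht
    have hanti : AntitoneOn (fun t => f t - y * t) (Set.Ici 0) := by
      refine antitoneOn_of_deriv_nonpos (convex_Ici 0) ?_ ?_ ?_
      · exact (hd.continuous.sub (by fun_prop)).continuousOn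
      · exact (hd.sub (by fun_prop)).differentiableOn
      · intro s hs
        rw [interior_Ici] at hs
        have : HasDerivAt (fun t => f t - y * t) (deriv f s - y * 1) s :=
          (hd s).hasDerivAt.sub ((hasDerivAt_id s).const_mul y)
        rw [this.deriv]
        linarith [hlt s (le_of_lt hs)]
    have := hanti (Set.self_mem_Ici) (show t ∈ Set.Ici (0 : ℝ) from ht) ht
    simp only [mul_zero, sub_zero] at this
    linarith
  have h := legendre_le_coe_iff.1 hc
  have hpos : 0 < x - y := sub_pos.2 hyx
  set t : ℝ := (|c + f 0| + 1) / (x - y) with ht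
  have ht0 : 0 ≤ t := by positivity
  have h1 := h t
  have h2 := hgrow t ht0
  have h3 : t * (x - y) = |c + f 0| + 1 := by rw [ht]; field_simp
  nlinarith [le_abs_self (c + f 0)]

/-! ### Exponential rates -/

theorem expRate_mono (μ : ℕ+ → Measure ℝ) {A B : Set ℝ} (h : A ⊆ B) (n : ℕ+) :
    expRate μ A n ≤ expRate μ B n := by
  unfold expRate
  refine mul_le_mul_of_nonneg_left ?_ ?_
  · exact ENNReal.log_monotone (measure_mono h)
  · exact_mod_cast (by positivity : (0 : ℝ) ≤ ((n : ℕ) : ℝ)⁻¹)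

theorem inv_mul_log_ofReal_exp (n : ℕ+) (c : ℝ) :
    ((((n : ℕ) : ℝ)⁻¹ : ℝ) : EReal) * ENNReal.log (ENNReal.ofReal (Real.exp ((n : ℕ) * c))) = c := by
  have hn : ((n : ℕ) : ℝ) ≠ 0 := by simp
  rw [ENNReal.log_ofReal_of_pos (Real.exp_pos _), Real.log_exp, ← EReal.coe_mul,
    inv_mul_cancel_left₀ hn]

theorem expRate_le_of_le_exp {μ : ℕ+ → Measure ℝ} {A : Set ℝ} {n : ℕ+} {c : ℝ}
    (h : μ n A ≤ ENNReal.ofReal (Real.exp ((n : ℕ) * c))) : expRate μ A n ≤ c := by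
  rw [← inv_mul_log_ofReal_exp n c]
  refine mul_le_mul_of_nonneg_left (ENNReal.log_monotone h) ?_
  exact_mod_cast (by positivity : (0 : ℝ) ≤ ((n : ℕ) : ℝ)⁻¹)

theorem le_expRate_of_exp_le {μ : ℕ+ → Measure ℝ} {A : Set ℝ} {n : ℕ+} {c : ℝ}
    (h : ENNReal.ofReal (Real.exp ((n : ℕ) * c)) ≤ μ n A) : (c : EReal) ≤ expRate μ A n := by
  rw [← inv_mul_log_ofReal_exp n c]
  refine mul_le_mul_of_nonneg_left (ENNReal.log_monotone h) ?_
  exact_mod_cast (by positivity : (0 : ℝ) ≤ ((n : ℕ) : ℝ)⁻¹)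

theorem tendsto_natCast_pnat : Tendsto (fun n : ℕ+ => ((n : ℕ) : ℝ)) atTop atTop :=
  tendsto_natCast_atTop_atTop.comp tendsto_PNat_val_atTop_atTop

/-- If `a n → a < 0`, then `exp (n * a n)` is eventually below any positive bound. -/
theorem eventually_exp_mul_lt {a : ℕ+ → ℝ} {l : ℝ} (ha : Tendsto a atTop (𝓝 l)) (hl : l < 0)
    {ε : ℝ} (hε : 0 < ε) : ∀ᶠ n : ℕ+ in atTop, Real.exp ((n : ℕ) * a n) < ε := by
  have h : Tendsto (fun n : ℕ+ => ((n : ℕ) : ℝ) * a n) atTop atBot :=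
    tendsto_natCast_pnat.atTop_mul_neg hl ha
  exact (Real.tendsto_exp_atBot.comp h).eventually_lt_const hε

/-! ### The Gärtner–Ellis theorem on the line -/

section GartnerEllis

variable {μ : ℕ+ → Measure ℝ} [∀ n, IsProbabilityMeasure (μ n)] {Ψ : ℝ → ℝ}

/-- Chernoff bound for right half-lines. -/
theorem eventually_measure_Ici_le
    (hint : ∀ n t, Integrable (fun x => Real.exp (t * id x)) (μ n))
    (hlim : ∀ t, Tendsto (fun n : ℕ+ => ((n : ℕ) : ℝ)⁻¹ * cgf id (μ n) ((n : ℕ) * t)) atTop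
      (𝓝 (Ψ t)))
    {b t c : ℝ} (ht : 0 ≤ t) (hc : c < t * b - Ψ t) :
    ∀ᶠ n : ℕ+ in atTop, μ n (Set.Ici b) ≤ ENNReal.ofReal (Real.exp ((n : ℕ) * -c)) := by
  filter_upwards [(hlim t).eventually_lt_const (show Ψ t < t * b - c by linarith)] with n hn
  have hn0 : (0 : ℝ) < ((n : ℕ) : ℝ) := by exact_mod_cast n.pos
  have h := measure_ge_le_exp_cgf (X := id) (μ := μ n) b
    (mul_nonneg hn0.le ht) (hint n _)
  rw [← ofReal_measureReal (measure_ne_top _ _)]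
  refine ENNReal.ofReal_le_ofReal (h.trans (Real.exp_le_exp.2 ?_))
  rw [inv_mul_lt_iff₀ hn0] at hn
  nlinarith

/-- Chernoff bound for left half-lines. -/
theorem eventually_measure_Iic_le
    (hint : ∀ n t, Integrable (fun x => Real.exp (t * id x)) (μ n))
    (hlim : ∀ t, Tendsto (fun n : ℕ+ => ((n : ℕ) : ℝ)⁻¹ * cgf id (μ n) ((n : ℕ) * t)) atTop
      (𝓝 (Ψ t)))
    {b t c : ℝ} (ht : t ≤ 0) (hc : c < t * b - Ψ t) :
    ∀ᶠ n : ℕ+ in atTop, μ n (Set.Iic b) ≤ ENNReal.ofReal (Real.exp ((n : ℕ) * -c)) := by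
  filter_upwards [(hlim t).eventually_lt_const (show Ψ t < t * b - c by linarith)] with n hn
  have hn0 : (0 : ℝ) < ((n : ℕ) : ℝ) := by exact_mod_cast n.pos
  have h := measure_le_le_exp_cgf (X := id) (μ := μ n) b
    (mul_nonpos_of_nonneg_of_nonpos hn0.le ht) (hint n _)
  rw [← ofReal_measureReal (measure_ne_top _ _)]
  refine ENNReal.ofReal_le_ofReal (h.trans (Real.exp_le_exp.2 ?_))
  rw [inv_mul_lt_iff₀ hn0] at hn
  nlinarith

/-- The tangent of `Ψ` at `0` bounds it from below. -/
theorem deriv_zero_mul_le (hconv : ConvexOn ℝ Set.univ Ψ) (hd : Differentiable ℝ Ψ)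
    (h0 : Ψ 0 = 0) (t : ℝ) : t * deriv Ψ 0 ≤ Ψ t := by
  rcases lt_trichotomy t 0 with ht | rfl | ht
  · have := hconv.slope_le_deriv (Set.mem_univ t) (Set.mem_univ 0) ht (hd 0)
    rw [slope_def_field, h0, div_le_iff₀ (by linarith)] at this
    linarith
  · simp [h0]
  · have := hconv.deriv_le_slope (Set.mem_univ 0) (Set.mem_univ t) ht (hd 0)
    rw [slope_def_field, h0, le_div_iff₀ (by linarith)] at this
    linarith

/-- A closed set that misses `m = Ψ'(0)` lies in two half-lines that start at points of the set, and
Chernoff's bound for these is governed by the values of `Ψ*` there. -/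
theorem eventually_measure_le_of_isClosed (hconv : ConvexOn ℝ Set.univ Ψ)
    (hd : Differentiable ℝ Ψ) (h0 : Ψ 0 = 0)
    (hint : ∀ n t, Integrable (fun x => Real.exp (t * id x)) (μ n))
    (hlim : ∀ t, Tendsto (fun n : ℕ+ => ((n : ℕ) : ℝ)⁻¹ * cgf id (μ n) ((n : ℕ) * t)) atTop
      (𝓝 (Ψ t)))
    {F : Set ℝ} (hF : IsClosed F) {c : ℝ} (hc : (c : EReal) < ⨅ x ∈ F, legendre Ψ x) :
    ∀ᶠ n : ℕ+ in atTop, μ n F ≤ ENNReal.ofReal (Real.exp ((n : ℕ) * -c)) := by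
  rcases lt_or_ge c 0 with hc0 | hc0
  · refine Eventually.of_forall fun n => prob_le_one.trans ?_
    rw [ENNReal.one_le_ofReal, Real.one_le_exp_iff]
    exact mul_nonneg (by positivity) (by linarith)
  obtain ⟨c', hcc', hc'⟩ := EReal.lt_iff_exists_real_btwn.1 hc
  rw [EReal.coe_lt_coe_iff] at hcc'
  set m := deriv Ψ 0 with hm
  have htan := deriv_zero_mul_le hconv hd h0
  have hex : ∀ x ∈ F, ∃ t, c' < t * x - Ψ t := by
    intro x hx
    have : (c' : EReal) < legendre Ψ x := hc'.trans_le (iInf₂_le x hx)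
    obtain ⟨t, ht⟩ := lt_iSup_iff.1 this
    exact ⟨t, by exact_mod_cast ht⟩
  have hmF : m ∉ F := by
    intro h
    obtain ⟨t, ht⟩ := hex m h
    linarith [htan t]
  have hright : ∀ᶠ n : ℕ+ in atTop,
      μ n (F ∩ Set.Ici m) ≤ ENNReal.ofReal (Real.exp ((n : ℕ) * -c')) := by
    rcases (F ∩ Set.Ici m).eq_empty_or_nonempty with he | hne
    · simp [he]
    have hbdd : BddBelow (F ∩ Set.Ici m) := ⟨m, fun x hx => hx.2⟩
    have hmem := (hF.inter isClosed_Ici).csInf_mem hne hbdd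
    set b := sInf (F ∩ Set.Ici m) with hb
    obtain ⟨t, ht⟩ := hex b hmem.1
    have hbm : m ≤ b := hmem.2
    have ht0 : 0 ≤ t := by
      by_contra! hneg
      nlinarith [htan t]
    filter_upwards [eventually_measure_Ici_le hint hlim ht0 ht] with n hn
    exact (measure_mono fun x hx => csInf_le hbdd hx).trans hn
  have hleft : ∀ᶠ n : ℕ+ in atTop,
      μ n (F ∩ Set.Iic m) ≤ ENNReal.ofReal (Real.exp ((n : ℕ) * -c')) := by
    rcases (F ∩ Set.Iic m).eq_empty_or_nonempty with he | hne
    · simp [he]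
    have hbdd : BddAbove (F ∩ Set.Iic m) := ⟨m, fun x hx => hx.2⟩
    have hmem := (hF.inter isClosed_Iic).csSup_mem hne hbdd
    set b := sSup (F ∩ Set.Iic m) with hb
    obtain ⟨t, ht⟩ := hex b hmem.1
    have hbm : b ≤ m := hmem.2
    have ht0 : t ≤ 0 := by
      by_contra! hneg
      nlinarith [htan t]
    filter_upwards [eventually_measure_Iic_le hint hlim ht0 ht] with n hn
    exact (measure_mono fun x hx => le_csSup hbdd hx).trans hn
  have hsmall := eventually_exp_mul_lt (a := fun _ => c - c') tendsto_const_nhds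
    (by linarith) (show (0 : ℝ) < 1 / 2 by norm_num)
  filter_upwards [hright, hleft, hsmall] with n h1 h2 h3
  have hsub : F ⊆ (F ∩ Set.Ici m) ∪ (F ∩ Set.Iic m) := fun x hx =>
    (le_total m x).imp (fun h => ⟨hx, h⟩) (fun h => ⟨hx, h⟩)
  refine ((measure_mono hsub).trans (measure_union_le _ _)).trans ((add_le_add h1 h2).trans ?_)
  rw [← ENNReal.ofReal_add (Real.exp_nonneg _) (Real.exp_nonneg _)]
  refine ENNReal.ofReal_le_ofReal ?_
  have h4 : Real.exp ((n : ℕ) * -c') = Real.exp ((n : ℕ) * -c) * Real.exp ((n : ℕ) * (c - c')) := by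
    rw [← Real.exp_add]; ring_nf
  have h5 := mul_le_mul_of_nonneg_left h3.le (Real.exp_nonneg ((n : ℕ) * -c))
  linarith

/-- Local lower bound at a slope `y = Ψ'(η)`. The exponentially tilted mass
`∫ exp (n η x) dμ n` concentrates near `y`: its parts beyond `y ± δ` are bounded
by Chernoff's method with the exponents `η ± s`, and for small `s` they are exponentially smaller than
the whole. -/
theorem eventually_le_measure_ball (hd : Differentiable ℝ Ψ)
    (hint : ∀ n t, Integrable (fun x => Real.exp (t * id x)) (μ n))
    (hlim : ∀ t, Tendsto (fun n : ℕ+ => ((n : ℕ) : ℝ)⁻¹ * cgf id (μ n) ((n : ℕ) * t)) atTop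
      (𝓝 (Ψ t)))
    {η δ c : ℝ} (hδ : 0 < δ) (hc : η * deriv Ψ η - Ψ η + |η| * δ < c) :
    ∀ᶠ n : ℕ+ in atTop,
      ENNReal.ofReal (Real.exp ((n : ℕ) * -c)) ≤ μ n (Metric.ball (deriv Ψ η) δ) := by
  set y := deriv Ψ η with hy
  obtain ⟨s, hs, hs1, hs2⟩ : ∃ s > 0, Ψ (η + s) - Ψ η - s * (y + δ) < 0 ∧
      Ψ (η - s) - Ψ η + s * (y - δ) < 0 := by
    have hder := (hd η).hasDerivAt
    have hlo := hasDerivAt_iff_isLittleO_nhds_zero.1 hder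
    have hev := hlo.def (half_pos hδ)
    obtain ⟨ρ, hρ, hb⟩ := Metric.eventually_nhds_iff.1 hev
    refine ⟨ρ / 2, half_pos hρ, ?_, ?_⟩
    · have h := hb (y := ρ / 2) (by rw [Real.dist_eq, sub_zero, abs_of_pos] <;> linarith)
      rw [Real.norm_eq_abs, Real.norm_eq_abs, abs_of_pos (half_pos hρ), smul_eq_mul] at h
      have := (abs_le.1 h).2
      nlinarith [mul_pos hρ hδ]
    · have h := hb (y := -(ρ / 2)) (by
        rw [Real.dist_eq, sub_zero, abs_neg, abs_of_pos] <;> linarith)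
      rw [Real.norm_eq_abs, Real.norm_eq_abs, abs_neg, abs_of_pos (half_pos hρ), smul_eq_mul,
        ← sub_eq_add_neg] at h
      have := (abs_le.1 h).2
      nlinarith [mul_pos hρ hδ]
  set a : ℝ → ℕ+ → ℝ := fun t n => ((n : ℕ) : ℝ)⁻¹ * cgf id (μ n) ((n : ℕ) * t) with ha
  have e1 := eventually_exp_mul_lt (a := fun n => a (η + s) n - a η n - s * (y + δ))
    (((hlim (η + s)).sub (hlim η)).sub_const _) hs1 (show (0 : ℝ) < 1 / 4 by norm_num)
  have e2 := eventually_exp_mul_lt (a := fun n => a (η - s) n - a η n + s * (y - δ))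
    (((hlim (η - s)).sub (hlim η)).add_const _) hs2 (show (0 : ℝ) < 1 / 4 by norm_num)
  have e3 := eventually_exp_mul_lt (a := fun n => η * y + |η| * δ - c - a η n)
    (((tendsto_const_nhds (x := η * y + |η| * δ - c)).sub (hlim η))) (by linarith)
    (show (0 : ℝ) < 1 / 2 by norm_num)
  filter_upwards [e1, e2, e3] with n h1 h2 h3
  have hn0 : (0 : ℝ) < ((n : ℕ) : ℝ) := by exact_mod_cast n.pos
  have hmgf : ∀ t, ∫ x, Real.exp (((n : ℕ) * t) * id x) ∂(μ n) = Real.exp ((n : ℕ) * a t n) := by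
    intro t
    have := exp_cgf (X := id) (hint n ((n : ℕ) * t))
    rw [ha]
    simp only [mul_inv_cancel_left₀ hn0.ne']
    rw [this, mgf]
  set B := Metric.ball y δ with hB
  -- Off the ball one of the last two terms is at least `exp (n η x)`.
  have hpt : ∀ x : ℝ, Real.exp (((n : ℕ) * η) * id x) ≤
      B.indicator (fun _ => Real.exp ((n : ℕ) * (η * y + |η| * δ))) x +
      Real.exp ((n : ℕ) * -(s * (y + δ))) * Real.exp (((n : ℕ) * (η + s)) * id x) +
      Real.exp ((n : ℕ) * (s * (y - δ))) * Real.exp (((n : ℕ) * (η - s)) * id x) := by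
    intro x
    rw [← Real.exp_add, ← Real.exp_add]
    simp only [id]
    have p1 := Real.exp_nonneg ((n : ℕ) * -(s * (y + δ)) + ((n : ℕ) * (η + s)) * x)
    have p2 := Real.exp_nonneg ((n : ℕ) * (s * (y - δ)) + ((n : ℕ) * (η - s)) * x)
    have p3 : 0 ≤ B.indicator (fun _ => Real.exp ((n : ℕ) * (η * y + |η| * δ))) x :=
      Set.indicator_nonneg (fun _ _ => Real.exp_nonneg _) x
    by_cases hx : x ∈ B
    · rw [Set.indicator_of_mem hx]
      have hx' : |x - y| < δ := by simpa [hB, Real.dist_eq] using hx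
      have : η * (x - y) ≤ |η| * δ := (le_abs_self _).trans (by
        rw [abs_mul]; exact mul_le_mul_of_nonneg_left hx'.le (abs_nonneg _))
      have : Real.exp ((n : ℕ) * η * x) ≤ Real.exp ((n : ℕ) * (η * y + |η| * δ)) := by
        rw [Real.exp_le_exp, mul_assoc]
        exact mul_le_mul_of_nonneg_left (by linarith) hn0.le
      linarith
    · have hx' : δ ≤ |x - y| := by simpa [hB, Real.dist_eq] using hx
      have hns := mul_pos hn0 hs
      rcases le_abs.1 hx' with h | h
      · have : Real.exp ((n : ℕ) * η * x) ≤
            Real.exp ((n : ℕ) * -(s * (y + δ)) + ((n : ℕ) * (η + s)) * x) := by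
          rw [Real.exp_le_exp]
          nlinarith [mul_nonneg hns.le (sub_nonneg.2 h)]
        linarith
      · have : Real.exp ((n : ℕ) * η * x) ≤
            Real.exp ((n : ℕ) * (s * (y - δ)) + ((n : ℕ) * (η - s)) * x) := by
          rw [Real.exp_le_exp]
          nlinarith [mul_nonneg hns.le (sub_nonneg.2 h)]
        linarith
  have hBm : MeasurableSet B := Metric.isOpen_ball.measurableSet
  have i1 : Integrable (B.indicator (fun _ => Real.exp ((n : ℕ) * (η * y + |η| * δ)))) (μ n) :=
    (integrable_const _).indicator hBm
  have i2 := (hint n ((n : ℕ) * (η + s))).const_mul (Real.exp ((n : ℕ) * -(s * (y + δ))))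
  have i3 := (hint n ((n : ℕ) * (η - s))).const_mul (Real.exp ((n : ℕ) * (s * (y - δ))))
  have i12 : Integrable (fun x => B.indicator (fun _ => Real.exp ((n : ℕ) * (η * y + |η| * δ))) x +
      Real.exp ((n : ℕ) * -(s * (y + δ))) * Real.exp (((n : ℕ) * (η + s)) * id x)) (μ n) :=
    i1.add i2
  have hle := integral_mono (hint n ((n : ℕ) * η)) (i12.add i3) hpt
  simp only [Pi.add_apply] at hle
  rw [integral_add i12 i3, integral_add i1 i2, integral_const_mul, integral_const_mul,
    hmgf, hmgf, hmgf, integral_indicator_const _ hBm, smul_eq_mul] at hle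
  have q1 : Real.exp ((n : ℕ) * -(s * (y + δ))) * Real.exp ((n : ℕ) * a (η + s) n) =
      Real.exp ((n : ℕ) * a η n) * Real.exp ((n : ℕ) * (a (η + s) n - a η n - s * (y + δ))) := by
    rw [← Real.exp_add, ← Real.exp_add]; ring_nf
  have q2 : Real.exp ((n : ℕ) * (s * (y - δ))) * Real.exp ((n : ℕ) * a (η - s) n) =
      Real.exp ((n : ℕ) * a η n) * Real.exp ((n : ℕ) * (a (η - s) n - a η n + s * (y - δ))) := by
    rw [← Real.exp_add, ← Real.exp_add]; ring_nf
  have q3 : Real.exp ((n : ℕ) * -c) * Real.exp ((n : ℕ) * (η * y + |η| * δ)) =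
      Real.exp ((n : ℕ) * a η n) * Real.exp ((n : ℕ) * (η * y + |η| * δ - c - a η n)) := by
    rw [← Real.exp_add, ← Real.exp_add]; ring_nf
  rw [q1, q2] at hle
  have hE := Real.exp_pos ((n : ℕ) * a η n)
  have r1 := mul_lt_mul_of_pos_left h1 hE
  have r2 := mul_lt_mul_of_pos_left h2 hE
  have r3 := mul_lt_mul_of_pos_left h3 hE
  rw [← q3] at r3
  rw [← ofReal_measureReal (measure_ne_top _ _)]
  refine ENNReal.ofReal_le_ofReal ?_
  refine le_of_mul_le_mul_right (a := Real.exp ((n : ℕ) * (η * y + |η| * δ))) ?_ (Real.exp_pos _)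
  linarith

/-- On the side of `x` that faces the minimizer `Ψ'(0)`, arbitrarily near `x`, there are slopes
`Ψ'(η)` whose rate does not exceed that of `x`. -/
theorem exists_deriv_mem_of_legendre_le (hd : Differentiable ℝ Ψ)
    {G : Set ℝ} (hG : IsOpen G) {x c : ℝ} (hx : x ∈ G) (hc : legendre Ψ x ≤ (c : EReal)) :
    ∃ η, deriv Ψ η ∈ G ∧ η * deriv Ψ η - Ψ η ≤ c := by
  have hle := legendre_le_coe_iff.1 hc
  obtain ⟨ρ, hρ, hball⟩ := Metric.isOpen_iff.1 hG x hx
  rcases lt_trichotomy (deriv Ψ 0) x with hm | hm | hm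
  · have hy : max (deriv Ψ 0) (x - ρ / 2) < x := max_lt hm (by linarith)
    obtain ⟨η, hη, he⟩ := exists_deriv_eq_of_legendre_le hd (le_max_left _ _) hy hc
    refine ⟨η, ?_, ?_⟩
    · apply hball
      rw [Metric.mem_ball, Real.dist_eq, abs_lt, he]
      constructor <;> linarith [le_max_right (deriv Ψ 0) (x - ρ / 2)]
    · rw [he]
      nlinarith [hle η, mul_nonneg hη (sub_nonneg.2 hy.le)]
  · exact ⟨0, hm ▸ hx, by simpa using hle 0⟩
  · have hder : ∀ t, deriv (fun t => Ψ (-t)) t = -deriv Ψ (-t) := fun t => deriv_comp_neg Ψ t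
    have hc' : legendre (fun t => Ψ (-t)) (-x) ≤ (c : EReal) :=
      legendre_le_coe_iff.2 fun t => by simpa using hle (-t)
    have hy : x < min (deriv Ψ 0) (x + ρ / 2) := lt_min hm (by linarith)
    obtain ⟨η, hη, he⟩ := exists_deriv_eq_of_legendre_le (f := fun t => Ψ (-t))
      (y := -min (deriv Ψ 0) (x + ρ / 2)) (hd.comp differentiable_neg)
      (by rw [hder, neg_zero, neg_le_neg_iff]; exact min_le_left _ _) (neg_lt_neg hy) hc'
    rw [hder, neg_inj] at he
    refine ⟨-η, ?_, ?_⟩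
    · apply hball
      rw [Metric.mem_ball, Real.dist_eq, abs_lt, he]
      constructor <;> linarith [min_le_right (deriv Ψ 0) (x + ρ / 2)]
    · rw [he]
      nlinarith [hle (-η), mul_nonneg hη (sub_nonneg.2 hy.le)]

/-- The Gärtner–Ellis theorem on the line for a limit `Ψ` that is finite and differentiable
everywhere. -/
theorem satisfiesLDP_legendre (hconv : ConvexOn ℝ Set.univ Ψ)
    (hd : Differentiable ℝ Ψ) (h0 : Ψ 0 = 0)
    (hint : ∀ n t, Integrable (fun x => Real.exp (t * id x)) (μ n))
    (hlim : ∀ t, Tendsto (fun n : ℕ+ => ((n : ℕ) : ℝ)⁻¹ * cgf id (μ n) ((n : ℕ) * t)) atTop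
      (𝓝 (Ψ t))) :
    SatisfiesLDP μ (legendre Ψ) where
  nonneg := legendre_nonneg h0
  lowerSemicontinuous := lowerSemicontinuous_legendre Ψ
  lower_bound Γ _ := by
    rw [EReal.neg_le]
    refine le_iInf₂ fun x hx => ?_
    refine EReal.le_of_forall_lt_iff_le.1 fun c hc => ?_
    obtain ⟨c', h1, h2⟩ := EReal.lt_iff_exists_real_btwn.1 hc
    rw [EReal.coe_lt_coe_iff] at h2
    obtain ⟨η, hη, hηc⟩ := exists_deriv_mem_of_legendre_le hd isOpen_interior hx h1.le
    obtain ⟨ρ, hρ, hball⟩ := Metric.isOpen_iff.1 isOpen_interior _ hη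
    have hpos : 0 < (c - c') / (|η| + 1) := div_pos (by linarith) (by positivity)
    set δ := min ρ ((c - c') / (|η| + 1)) with hδdef
    have hδ : 0 < δ := lt_min hρ hpos
    have hηδ : |η| * δ < c - c' := by
      have h3 : δ * (|η| + 1) ≤ c - c' := by
        rw [← le_div_iff₀ (by positivity)]; exact min_le_right _ _
      linarith
    rw [EReal.neg_le, ← EReal.coe_neg]
    refine le_liminf_of_le (by isBoundedDefault) ?_
    filter_upwards [eventually_le_measure_ball hd hint hlim hδ
      (show η * deriv Ψ η - Ψ η + |η| * δ < c by linarith)] with n hn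
    exact le_expRate_of_exp_le (hn.trans (measure_mono
      ((Metric.ball_subset_ball (min_le_left _ _)).trans hball)))
  liminf_le_limsup Γ _ :=
    (liminf_le_limsup (by isBoundedDefault) (by isBoundedDefault)).trans
      (limsup_le_limsup (Eventually.of_forall fun n =>
        expRate_mono μ (interior_subset.trans subset_closure) n))
  upper_bound Γ _ := by
    rw [EReal.le_neg]
    refine EReal.ge_of_forall_gt_iff_ge.1 fun c hc => ?_
    rw [EReal.le_neg, ← EReal.coe_neg]
    refine limsup_le_of_le (by isBoundedDefault) ?_
    filter_upwards [eventually_measure_le_of_isClosed hconv hd h0 hint hlim isClosed_closure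
      hc] with n hn
    exact expRate_le_of_le_exp hn

end GartnerEllis

/-! ### The uniform measure on the sphere as the law of a normalized Gaussian vector -/

section Sphere

variable {E : Type*} [NormedAddCommGroup E] [InnerProductSpace ℝ E] [FiniteDimensional ℝ E]
  [MeasurableSpace E] [BorelSpace E]

theorem stdGaussian_eq_withDensity :
    stdGaussian E = (volume : Measure E).withDensity fun x => ENNReal.ofReal
      (((2 * Real.pi) ^ (Module.finrank ℝ E / 2 : ℝ))⁻¹ * Real.exp (-(1 / 2) * ‖x‖ ^ 2)) := by
  set c : ℝ := ((2 * Real.pi) ^ (Module.finrank ℝ E / 2 : ℝ))⁻¹ with hc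
  have hcpos : 0 < c := by positivity
  have hint : Integrable (fun x : E => c * Real.exp (-(1 / 2) * ‖x‖ ^ 2)) := by
    have h := (GaussianFourier.integrable_cexp_neg_mul_sq_norm_add (V := E) (b := 1 / 2)
      (by norm_num) 0 0).re
    refine Integrable.const_mul (h.congr (Eventually.of_forall fun x => ?_)) c
    have : (-(1 / 2) * (‖x‖ : ℂ) ^ 2 + 0 * (inner ℝ (0 : E) x : ℝ) : ℂ)
        = ((-(1 / 2) * ‖x‖ ^ 2 : ℝ) : ℂ) := by push_cast; ring
    change (Complex.exp _).re = _
    rw [this, Complex.exp_ofReal_re]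
  have : IsFiniteMeasure ((volume : Measure E).withDensity fun x => ENNReal.ofReal
      (c * Real.exp (-(1 / 2) * ‖x‖ ^ 2))) :=
    isFiniteMeasure_withDensity_ofReal hint.2
  refine Measure.ext_of_charFun (funext fun t => ?_)
  rw [charFun_stdGaussian, charFun_apply,
    integral_withDensity_eq_integral_toReal_smul (by fun_prop) (by simp)]
  have h := GaussianFourier.integral_cexp_neg_mul_sq_norm_add (V := E) (b := 1 / 2)
    (by norm_num) Complex.I t
  have h2 : ∀ x : E, (ENNReal.ofReal (c * Real.exp (-(1 / 2) * ‖x‖ ^ 2))).toReal •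
      Complex.exp ((inner ℝ x t : ℝ) * Complex.I) =
      (c : ℂ) * Complex.exp (-(1 / 2) * (‖x‖ : ℂ) ^ 2 + Complex.I * (inner ℝ t x : ℝ)) := by
    intro x
    rw [ENNReal.toReal_ofReal (by positivity), Complex.real_smul, Complex.exp_add,
      real_inner_comm t x]
    push_cast
    ring_nf
  simp_rw [h2]
  rw [integral_const_mul, h, ← mul_assoc]
  have h3 : (c : ℂ) * ((Real.pi : ℂ) / (1 / 2)) ^ ((Module.finrank ℝ E : ℂ) / 2) = 1 := by
    have e1 : ((Real.pi : ℂ) / (1 / 2)) = ((2 * Real.pi : ℝ) : ℂ) := by push_cast; ring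
    have e2 : ((Module.finrank ℝ E : ℂ) / 2) = ((Module.finrank ℝ E / 2 : ℝ) : ℂ) := by
      push_cast; ring
    rw [e1, e2, ← Complex.ofReal_cpow (by positivity), ← Complex.ofReal_mul, hc,
      inv_mul_cancel₀ (by positivity), Complex.ofReal_one]
  rw [h3, one_mul]
  congr 1
  rw [Complex.I_sq]
  ring

/-- Integration in polar coordinates of a function of the direction times a function of the norm. -/
theorem lintegral_indicator_normalize_mul [Nontrivial E] {S : Set E} (hS : MeasurableSet S)
    {φ : ℝ → ENNReal} (hφ : Measurable φ) :
    ∫⁻ x : E, S.indicator 1 (‖x‖⁻¹ • x) * φ ‖x‖ =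
      (volume : Measure E).toSphere (Subtype.val ⁻¹' S) *
        ∫⁻ r, φ (r : ℝ) ∂(Measure.volumeIoiPow (Module.finrank ℝ E - 1)) := by
  have hmp := (volume : Measure E).measurePreserving_homeomorphUnitSphereProd
  have hind : Measurable (S.indicator (1 : E → ENNReal)) := measurable_one.indicator hS
  have h1 : Measurable fun s : Metric.sphere (0 : E) 1 => S.indicator (1 : E → ENNReal) s :=
    hind.comp measurable_subtype_coe
  have h2 : Measurable fun r : Set.Ioi (0 : ℝ) => φ r := hφ.comp measurable_subtype_coe
  calc ∫⁻ x : E, S.indicator 1 (‖x‖⁻¹ • x) * φ ‖x‖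
      = ∫⁻ x in ({0}ᶜ : Set E), S.indicator 1 (‖x‖⁻¹ • x) * φ ‖x‖ := by
        rw [restrict_compl_singleton]
    _ = ∫⁻ x : ({0}ᶜ : Set E), S.indicator 1 (‖(x : E)‖⁻¹ • (x : E)) * φ ‖(x : E)‖
          ∂((volume : Measure E).comap Subtype.val) :=
        (lintegral_subtype_comap (measurableSet_singleton _).compl _).symm
    _ = ∫⁻ p, S.indicator 1 (p.1 : E) * φ (p.2 : ℝ) ∂((volume : Measure E).toSphere.prod
          (Measure.volumeIoiPow (Module.finrank ℝ E - 1))) := by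
        rw [← hmp.lintegral_comp (f := fun p => S.indicator 1 (p.1 : E) * φ (p.2 : ℝ))
          ((h1.comp measurable_fst).mul (h2.comp measurable_snd))]
        simp
    _ = _ := by
        rw [lintegral_prod_mul h1.aemeasurable h2.aemeasurable]
        congr 1
        rw [← lintegral_indicator_one (measurable_subtype_coe hS)]
        rfl

theorem stdGaussian_normalize_preimage [Nontrivial E] {S : Set E} (hS : MeasurableSet S) :
    stdGaussian E {x | ‖x‖⁻¹ • x ∈ S} =
      ((volume : Measure E).toSphere Set.univ)⁻¹ *
        (volume : Measure E).toSphere (Subtype.val ⁻¹' S) := by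
  set c : ℝ := ((2 * Real.pi) ^ (Module.finrank ℝ E / 2 : ℝ))⁻¹ with hc
  set φ : ℝ → ENNReal := fun r => ENNReal.ofReal (c * Real.exp (-(1 / 2) * r ^ 2)) with hφdef
  have hφ : Measurable φ := by fun_prop
  have key : ∀ {T : Set E}, MeasurableSet T → stdGaussian E {x | ‖x‖⁻¹ • x ∈ T} =
      (volume : Measure E).toSphere (Subtype.val ⁻¹' T) *
        ∫⁻ r, φ (r : ℝ) ∂(Measure.volumeIoiPow (Module.finrank ℝ E - 1)) := by
    intro T hT
    have hmeas : MeasurableSet {x : E | ‖x‖⁻¹ • x ∈ T} :=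
      (measurable_norm.inv.smul measurable_id) hT
    rw [← lintegral_indicator_normalize_mul hT hφ, stdGaussian_eq_withDensity,
      withDensity_apply _ hmeas, ← lintegral_indicator hmeas]
    refine lintegral_congr fun x => ?_
    by_cases hx : ‖x‖⁻¹ • x ∈ T
    · rw [Set.indicator_of_mem (show x ∈ {x : E | ‖x‖⁻¹ • x ∈ T} from hx),
        Set.indicator_of_mem hx, Pi.one_apply, one_mul]
    · rw [Set.indicator_of_notMem (show x ∉ {x : E | ‖x‖⁻¹ • x ∈ T} from hx),
        Set.indicator_of_notMem hx, zero_mul]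
  have huniv := key MeasurableSet.univ
  simp only [Set.mem_univ, Set.preimage_univ] at huniv
  rw [show {x : E | True} = Set.univ from rfl, measure_univ] at huniv
  rw [key hS, mul_comm, ENNReal.eq_inv_of_mul_eq_one_left huniv.symm, inv_inv]

end Sphere

theorem uniformSphere_preimage_val (n : ℕ+) {S : Set (EuclideanSpace ℝ (Fin (n : ℕ)))}
    (hS : MeasurableSet S) :
    uniformSphere n (Subtype.val ⁻¹' S) =
      stdGaussian (EuclideanSpace ℝ (Fin (n : ℕ))) {x | ‖x‖⁻¹ • x ∈ S} := by
  have : Nonempty (Fin (n : ℕ)) := ⟨⟨0, n.pos⟩⟩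
  rw [stdGaussian_normalize_preimage hS, uniformSphere, Measure.smul_apply, smul_eq_mul]

/-! ### Fourth moments of independent sums -/

section FourthMoment

variable {Ω ι : Type*} [MeasurableSpace Ω] {P : Measure Ω} [IsProbabilityMeasure P]

theorem MeasureTheory.MemLp.integrable_pow_of_le_four {Y : Ω → ℝ} (hY : MemLp Y 4 P)
    {k : ℕ} (hk : k ≤ 4) :
    Integrable (fun ω => Y ω ^ k) P := by
  rcases Nat.eq_zero_or_pos k with rfl | hk0
  · simp
  have h : MemLp Y k P := hY.mono_exponent (by exact_mod_cast hk)
  have h2 := h.integrable_norm_pow hk0.ne'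
  refine h2.mono' (hY.aestronglyMeasurable.pow k) (Eventually.of_forall fun ω => ?_)
  simp

/-- The cross terms of odd order vanish, so the fourth moment of a centred independent sum grows
like the square of the number of terms. -/
theorem integral_sum_pow_four_le {Y : ι → Ω → ℝ} (hind : iIndepFun Y P)
    (hmeas : ∀ i, Measurable (Y i)) (hY : ∀ i, MemLp (Y i) 4 P) (hmean : ∀ i, ∫ ω, Y i ω ∂P = 0)
    {V M : ℝ} (hV : ∀ i, ∫ ω, Y i ω ^ 2 ∂P ≤ V) (hM : ∀ i, ∫ ω, Y i ω ^ 4 ∂P ≤ M)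
    (s : Finset ι) :
    ∫ ω, (∑ i ∈ s, Y i ω) ^ 2 ∂P ≤ s.card * V ∧
      ∫ ω, (∑ i ∈ s, Y i ω) ^ 4 ∂P ≤ s.card * M + 3 * s.card ^ 2 * V ^ 2 := by
  classical
  induction s using Finset.induction_on with
  | empty => simp
  | insert a s ha ih =>
    set S : Ω → ℝ := fun ω => ∑ i ∈ s, Y i ω with hS
    have hSLp : MemLp S 4 P := memLp_finsetSum s fun i _ => hY i
    have hSY : IndepFun S (Y a) P := by
      have := hind.indepFun_finsetSum_of_notMem hmeas ha
      convert this using 1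
      ext ω; simp [hS]
    have hpow : ∀ j k : ℕ, IndepFun (fun ω => S ω ^ j) (fun ω => Y a ω ^ k) P := fun j k =>
      hSY.comp (φ := fun x => x ^ j) (ψ := fun x => x ^ k) (by fun_prop) (by fun_prop)
    have hi : ∀ {j k : ℕ}, j ≤ 4 → k ≤ 4 → Integrable (fun ω => S ω ^ j * Y a ω ^ k) P :=
      fun {j k} hj hk => (hpow j k).integrable_mul (MemLp.integrable_pow_of_le_four hSLp hj)
        (MemLp.integrable_pow_of_le_four (hY a) hk)
    have hm : ∀ {j k : ℕ}, j ≤ 4 → k ≤ 4 → ∫ ω, S ω ^ j * Y a ω ^ k ∂P =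
        (∫ ω, S ω ^ j ∂P) * ∫ ω, Y a ω ^ k ∂P := fun {j k} hj hk =>
      (hpow j k).integral_fun_mul_eq_mul_integral
        (MemLp.integrable_pow_of_le_four hSLp hj).aestronglyMeasurable
        (MemLp.integrable_pow_of_le_four (hY a) hk).aestronglyMeasurable
    have hmean1 : ∫ ω, Y a ω ^ 1 ∂P = 0 := by simpa using hmean a
    have hSmean : ∫ ω, S ω ^ 1 ∂P = 0 := by
      simp only [pow_one, hS]
      rw [integral_finsetSum _ fun i _ => (hY i).integrable (by norm_num)]
      exact Finset.sum_eq_zero fun i _ => hmean i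
    obtain ⟨ih2, ih4⟩ := ih
    have hV0 : 0 ≤ V := (integral_nonneg fun ω => sq_nonneg (Y a ω)).trans (hV a)
    have hS0 : 0 ≤ ∫ ω, S ω ^ 2 ∂P := integral_nonneg fun ω => sq_nonneg (S ω)
    have hY0 : 0 ≤ ∫ ω, Y a ω ^ 2 ∂P := integral_nonneg fun ω => sq_nonneg (Y a ω)
    have hexp : ∀ n : ℕ, n ≤ 4 → ∫ ω, (∑ i ∈ insert a s, Y i ω) ^ n ∂P =
        ∑ m ∈ Finset.range (n + 1),
          (∫ ω, S ω ^ m ∂P) * (∫ ω, Y a ω ^ (n - m) ∂P) * n.choose m := by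
      intro n hn
      have e : ∀ ω, (∑ i ∈ insert a s, Y i ω) ^ n =
          ∑ m ∈ Finset.range (n + 1), S ω ^ m * Y a ω ^ (n - m) * n.choose m := by
        intro ω
        rw [Finset.sum_insert ha, add_comm, add_pow]
      simp_rw [e]
      rw [integral_finsetSum _ fun m hm => (hi (by grind) (by grind)).mul_const _]
      refine Finset.sum_congr rfl fun m hm' => ?_
      rw [integral_mul_const, hm (by grind) (by grind)]
    have h2 := hexp 2 (by norm_num)
    have h4 := hexp 4 (by norm_num)
    simp only [Finset.sum_range_succ, Finset.sum_range_zero, Nat.sub_zero, Nat.sub_self,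
      Nat.reduceSub, hmean1, hSmean, pow_zero, integral_const, probReal_univ, smul_eq_mul] at h2 h4
    norm_num [Nat.choose] at h2 h4
    rw [h2, h4, Finset.card_insert_of_notMem ha]
    push_cast
    have hprod := mul_le_mul ih2 (hV a) hY0 (by positivity)
    have hVa := hV a
    have hMa := hM a
    have hk : (0 : ℝ) ≤ s.card := by positivity
    constructor
    · linarith
    · nlinarith [sq_nonneg V]

/-- Chebyshev's inequality of order four for empirical means. -/
theorem exists_measure_pi_abs_mean_sub_ge_le {ν : Measure ℝ} [IsProbabilityMeasure ν]
    {f : ℝ → ℝ} (hf : Measurable f) (hf4 : MemLp f 4 ν) {δ : ℝ} (hδ : 0 < δ) :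
    ∃ C : ℝ, ∀ n : ℕ+, (Measure.pi fun _ : Fin (n : ℕ) => ν)
      {x | δ ≤ |((n : ℕ) : ℝ)⁻¹ * ∑ i, f (x i) - ∫ u, f u ∂ν|} ≤
        ENNReal.ofReal (C / ((n : ℕ) : ℝ) ^ 2) := by
  set m := ∫ u, f u ∂ν with hm
  set V := ∫ u, (f u - m) ^ 2 ∂ν
  set M := ∫ u, (f u - m) ^ 4 ∂ν
  have hM0 : 0 ≤ M := integral_nonneg fun u => by positivity
  refine ⟨(M + 3 * V ^ 2) / δ ^ 4, fun n => ?_⟩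
  set Q := Measure.pi fun _ : Fin (n : ℕ) => ν
  have hn1 : (1 : ℝ) ≤ ((n : ℕ) : ℝ) := by exact_mod_cast n.pos
  have hg : MemLp (fun u => f u - m) 4 ν := hf4.sub (memLp_const m)
  set Y : Fin (n : ℕ) → (Fin (n : ℕ) → ℝ) → ℝ := fun i x => f (x i) - m with hY
  have hmp : ∀ i, MeasurePreserving (fun x : Fin (n : ℕ) → ℝ => x i) Q ν := fun i =>
    measurePreserving_eval _ i
  have hYm : ∀ i, Measurable (Y i) := fun i => by fun_prop
  have hYLp : ∀ i, MemLp (Y i) 4 Q := fun i => hg.comp_measurePreserving (hmp i)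
  have hint : ∀ (g : ℝ → ℝ), Measurable g → ∀ i, ∫ x, g (x i) ∂Q = ∫ u, g u ∂ν := by
    intro g hg i
    rw [← (hmp i).map_eq, integral_map (measurable_pi_apply i).aemeasurable
      hg.aestronglyMeasurable]
  have hYind : iIndepFun Y Q :=
    iIndepFun_pi (X := fun (_ : Fin (n : ℕ)) u => f u - m) fun i => by fun_prop
  have hmean : ∀ i, ∫ x, Y i x ∂Q = 0 := by
    intro i
    rw [hint (fun u => f u - m) (by fun_prop) i,
      integral_sub (hf4.integrable (by norm_num)) (integrable_const m)]
    simp [hm]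
  have h4 := (integral_sum_pow_four_le hYind hYm hYLp hmean
    (fun i => (hint (fun u => (f u - m) ^ 2) (by fun_prop) i).le)
    (fun i => (hint (fun u => (f u - m) ^ 4) (by fun_prop) i).le) Finset.univ).2
  rw [Finset.card_univ, Fintype.card_fin] at h4
  have hSint : Integrable (fun x => (∑ i, Y i x) ^ 4) Q :=
    MemLp.integrable_pow_of_le_four (memLp_finsetSum _ fun i _ => hYLp i) le_rfl
  have hmarkov := mul_meas_ge_le_integral_of_nonneg
    (Eventually.of_forall fun x => by positivity) hSint ((((n : ℕ) : ℝ) * δ) ^ 4)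
  have hsub : {x : Fin (n : ℕ) → ℝ | δ ≤ |((n : ℕ) : ℝ)⁻¹ * ∑ i, f (x i) - m|} ⊆
      {x | (((n : ℕ) : ℝ) * δ) ^ 4 ≤ (∑ i, Y i x) ^ 4} := by
    intro x hx
    simp only [Set.mem_ofPred_eq] at hx ⊢
    have e : ∑ i, Y i x = ((n : ℕ) : ℝ) * (((n : ℕ) : ℝ)⁻¹ * ∑ i, f (x i) - m) := by
      simp only [hY, Finset.sum_sub_distrib, Finset.sum_const, Finset.card_univ, Fintype.card_fin,
        nsmul_eq_mul]
      field_simp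
    rw [e, ← Even.pow_abs (by decide : Even 4) (_ * (_ - _)), abs_mul,
      abs_of_nonneg (by linarith : (0 : ℝ) ≤ (n : ℕ))]
    gcongr
  refine (measure_mono hsub).trans ?_
  rw [← ofReal_measureReal (measure_ne_top _ _)]
  refine ENNReal.ofReal_le_ofReal ?_
  have hpos : 0 < (((n : ℕ) : ℝ) * δ) ^ 4 := by positivity
  rw [div_div, le_div_iff₀ (by positivity)]
  have h5 : Q.real {x | (((n : ℕ) : ℝ) * δ) ^ 4 ≤ (∑ i, Y i x) ^ 4} *
      (((n : ℕ) : ℝ) * δ) ^ 4 ≤ (M + 3 * V ^ 2) * ((n : ℕ) : ℝ) ^ 2 := by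
    have : ((n : ℕ) : ℝ) * M ≤ ((n : ℕ) : ℝ) ^ 2 * M :=
      mul_le_mul_of_nonneg_right (by nlinarith) hM0
    linarith
  refine le_of_mul_le_mul_right (a := ((n : ℕ) : ℝ) ^ 2) ?_ (by positivity)
  linarith

end FourthMoment

/-! ### Convergence of empirical means along random directions -/

/-- A convex function on the line that is close to a continuous function `Ψ` at finitely many
rational points is close to `Ψ t` near `t`. Three points suffice: two on the left of `t`, from which
convexity extrapolates a lower bound, and one on the right. -/
theorem exists_forall_convexOn_abs_sub_lt {Ψ : ℝ → ℝ} (hΨ : Continuous Ψ) (t : ℝ) {ε : ℝ}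
    (hε : 0 < ε) :
    ∃ (Q : Finset ℚ) (δ : ℝ), 0 < δ ∧ ∀ f : ℝ → ℝ, ConvexOn ℝ Set.univ f →
      (∀ q ∈ Q, |f q - Ψ q| < δ) → ∀ s, |s - t| < δ → |f s - Ψ t| < ε := by
  obtain ⟨h, hh, hcont⟩ := Metric.continuous_iff.1 hΨ t (ε / 32) (by positivity)
  obtain ⟨a, ha1, ha2⟩ := exists_rat_btwn (show t - h < t - 3 / 4 * h by linarith)
  obtain ⟨b, hb1, hb2⟩ := exists_rat_btwn (show t - h / 2 < t - h / 4 by linarith)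
  obtain ⟨d, hd1, hd2⟩ := exists_rat_btwn (show t + h / 2 < t + h by linarith)
  refine ⟨{a, b, d}, min (h / 8) (ε / 32), by positivity, fun f hf hQ s hs => ?_⟩
  have hnear : ∀ q : ℚ, q ∈ ({a, b, d} : Finset ℚ) → |(q : ℝ) - t| < h →
      |f q - Ψ t| < ε / 16 := by
    intro q hq hqt
    have h1 := (hQ q hq).trans_le (min_le_right _ _)
    have h2 := hcont q (by rwa [Real.dist_eq])
    rw [Real.dist_eq] at h2
    have := abs_sub_le (f q) (Ψ q) (Ψ t)
    linarith
  have fa := abs_lt.1 (hnear a (by simp) (abs_lt.2 ⟨by linarith, by linarith⟩))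
  have fb := abs_lt.1 (hnear b (by simp) (abs_lt.2 ⟨by linarith, by linarith⟩))
  have fd := abs_lt.1 (hnear d (by simp) (abs_lt.2 ⟨by linarith, by linarith⟩))
  have hs' := abs_lt.1 (hs.trans_le (min_le_left _ _))
  have hbs : (b : ℝ) < s := by linarith
  have hsd : s < d := by linarith
  rw [abs_lt]
  constructor
  · have hslope := hf.slope_mono_adjacent (Set.mem_univ (a : ℝ)) (Set.mem_univ s)
      (show (a : ℝ) < b by linarith) hbs
    rw [div_le_div_iff₀ (by linarith) (by linarith)] at hslope
    -- The ratio `(s - b) / (b - a)` is at most `5 / 2`.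
    have hratio : s - b ≤ 5 / 2 * (b - a) := by linarith
    have hba : (0 : ℝ) < b - a := by linarith
    have h1 : -(ε / 8) * (s - b) ≤ (f b - f a) * (s - b) :=
      mul_le_mul_of_nonneg_right (by linarith) (by linarith)
    have h2 : -(5 / 16 * ε) * (b - a) ≤ (f s - f b) * (b - a) := by nlinarith
    have h3 := le_of_mul_le_mul_right h2 hba
    linarith
  · have hle := hf.le_max_of_mem_Icc (Set.mem_univ (b : ℝ)) (Set.mem_univ (d : ℝ))
      ⟨hbs.le, hsd.le⟩
    have : max (f b) (f d) < Ψ t + ε := max_lt (by linarith) (by linarith)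
    linarith

theorem memLp_four_of_lintegral_ne_top {Ω : Type*} [MeasurableSpace Ω] {μ : Measure Ω} {f : Ω → ℝ}
    (hf : AEStronglyMeasurable f μ) (h : ∫⁻ ω, ‖f ω‖ₑ ^ 4 ∂μ ≠ ⊤) : MemLp f 4 μ := by
  refine ⟨hf, (eLpNorm_lt_top_iff_lintegral_rpow_enorm_lt_top (by norm_num) (by norm_num)).2 ?_⟩
  have : ((4 : ENNReal).toReal) = ((4 : ℕ) : ℝ) := by norm_num
  simp_rw [this, ENNReal.rpow_natCast]
  exact h.lt_top

theorem memLp_sq_gaussianReal : MemLp (fun u : ℝ => u ^ 2) 4 (gaussianReal 0 1) := by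
  have h : Integrable (fun u : ℝ => ‖u‖ ^ 8) (gaussianReal 0 1) :=
    (memLp_id_gaussianReal (μ := 0) (v := 1) 8).integrable_norm_pow (by norm_num)
  refine memLp_four_of_lintegral_ne_top (by fun_prop) ?_
  convert h.2.ne using 3 with u
  simp [← pow_mul]

theorem integral_sq_gaussianReal : ∫ u, u ^ 2 ∂(gaussianReal 0 1) = 1 := by
  have h := variance_of_integral_eq_zero (X := id) (μ := gaussianReal 0 1) aemeasurable_id
    (by simp)
  rw [variance_id_gaussianReal] at h
  simpa using h.symm

/-- The empirical mean `n⁻¹ ∑ᵢ L(t √n xᵢ)` of a function over the coordinates of a vector `x` of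
`ℝⁿ`. The factor `√n` gives the coordinates of a unit vector `x` the order of magnitude `1`. -/
noncomputable def directionalMean (L : ℝ → ℝ) (n : ℕ+)
    (x : EuclideanSpace ℝ (Fin (n : ℕ))) (t : ℝ) : ℝ :=
  ((n : ℕ) : ℝ)⁻¹ * ∑ i, L (t * (√((n : ℕ) : ℝ) * x i))

theorem convexOn_directionalMean {L : ℝ → ℝ} (hL : ConvexOn ℝ Set.univ L) (n : ℕ+)
    (x : EuclideanSpace ℝ (Fin (n : ℕ))) : ConvexOn ℝ Set.univ (directionalMean L n x) := by
  refine ⟨convex_univ, fun s _ t _ a b ha hb hab => ?_⟩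
  simp only [directionalMean, smul_eq_mul]
  have : ∀ i, L ((a * s + b * t) * (√((n : ℕ) : ℝ) * x i)) ≤
      a * L (s * (√((n : ℕ) : ℝ) * x i)) + b * L (t * (√((n : ℕ) : ℝ) * x i)) := by
    intro i
    have := hL.2 (Set.mem_univ (s * (√((n : ℕ) : ℝ) * x i)))
      (Set.mem_univ (t * (√((n : ℕ) : ℝ) * x i))) ha hb hab
    simp only [smul_eq_mul] at this
    rwa [show (a * s + b * t) * (√((n : ℕ) : ℝ) * x i) =
      a * (s * (√((n : ℕ) : ℝ) * x i)) + b * (t * (√((n : ℕ) : ℝ) * x i)) by ring]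
  calc _ ≤ ((n : ℕ) : ℝ)⁻¹ * ∑ i, (a * L (s * (√((n : ℕ) : ℝ) * x i)) +
        b * L (t * (√((n : ℕ) : ℝ) * x i))) :=
        mul_le_mul_of_nonneg_left (Finset.sum_le_sum fun i _ => this i) (by positivity)
    _ = _ := by
        rw [Finset.sum_add_distrib, ← Finset.mul_sum, ← Finset.mul_sum]
        ring

theorem exists_stdGaussian_abs_mean_sub_ge_le {f : ℝ → ℝ} (hf : Measurable f)
    (hf4 : MemLp f 4 (gaussianReal 0 1)) {δ : ℝ} (hδ : 0 < δ) :
    ∃ C : ℝ, ∀ n : ℕ+, stdGaussian (EuclideanSpace ℝ (Fin (n : ℕ)))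
      {x | δ ≤ |((n : ℕ) : ℝ)⁻¹ * ∑ i, f (x i) - ∫ u, f u ∂(gaussianReal 0 1)|} ≤
        ENNReal.ofReal (C / ((n : ℕ) : ℝ) ^ 2) := by
  obtain ⟨C, hC⟩ := exists_measure_pi_abs_mean_sub_ge_le hf hf4 hδ
  refine ⟨C, fun n => ?_⟩
  rw [← map_pi_eq_stdGaussian, Measure.map_apply (by fun_prop)]
  · exact hC n
  · exact measurableSet_le measurable_const (by fun_prop)

theorem tsum_ofReal_div_sq_ne_top (C : ℝ) :
    ∑' n : ℕ+, ENNReal.ofReal (C / ((n : ℕ) : ℝ) ^ 2) ≠ ⊤ := by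
  have h : Summable fun n : ℕ => |C| / (n : ℝ) ^ 2 := by
    simpa [div_eq_mul_inv] using (Real.summable_nat_pow_inv.2 (by norm_num : 1 < 2)).mul_left |C|
  have h2 : Summable fun n : ℕ+ => |C| / ((n : ℕ) : ℝ) ^ 2 := h.comp_injective PNat.coe_injective
  refine ne_top_of_le_ne_top h2.tsum_ofReal_ne_top (ENNReal.tsum_le_tsum fun n => ?_)
  gcongr
  exact le_abs_self C

/-- Deviations of the empirical means along a uniform direction have summable probability.
The direction is realized as `Z / ‖Z‖` for a Gaussian vector `Z`, whose empirical mean at `t` is that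
along `Z` at the random argument `t √n / ‖Z‖`; convexity absorbs the small change of argument. -/
theorem tsum_uniformSphere_abs_directionalMean_sub_ne_top {L : ℝ → ℝ}
    (hL : ConvexOn ℝ Set.univ L)
    (hL4 : ∀ t, MemLp (fun u => L (t * u)) 4 (gaussianReal 0 1)) {Ψ : ℝ → ℝ} (hΨ : Continuous Ψ)
    (hΨL : ∀ t, Ψ t = ∫ u, L (t * u) ∂(gaussianReal 0 1)) (t : ℝ) {ε : ℝ} (hε : 0 < ε) :
    ∑' n : ℕ+, uniformSphere n {s | ε ≤ |directionalMean L n s t - Ψ t|} ≠ ⊤ := by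
  have hLc : Continuous L := by
    rw [← continuousOn_univ]
    exact hL.continuousOn isOpen_univ
  obtain ⟨Q, δ, hδ, hstab⟩ := exists_forall_convexOn_abs_sub_lt hΨ t hε
  -- `t / √r` is `δ`-close to `t` for `r` close to `1`.
  obtain ⟨ρ, hρ, hρt⟩ : ∃ ρ > 0, ∀ r : ℝ, |r - 1| < ρ → |t / √r - t| < δ ∧ 0 < r := by
    have hc : ContinuousAt (fun r : ℝ => t / √r) 1 :=
      continuousAt_const.div Real.continuous_sqrt.continuousAt (by simp)
    obtain ⟨ρ, hρ, h⟩ := Metric.continuousAt_iff.1 hc δ hδ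
    refine ⟨min ρ 1, by positivity, fun r hr => ⟨?_, ?_⟩⟩
    · have := h (x := r) (by rw [Real.dist_eq]; exact hr.trans_le (min_le_left _ _))
      simpa [Real.dist_eq] using this
    · linarith [(abs_lt.1 (hr.trans_le (min_le_right _ _))).1]
  have hdev : ∀ q : ℚ, ∃ C : ℝ, ∀ n : ℕ+, stdGaussian (EuclideanSpace ℝ (Fin (n : ℕ)))
      {x | δ ≤ |((n : ℕ) : ℝ)⁻¹ * ∑ i, L (q * x i) - Ψ q|} ≤
        ENNReal.ofReal (C / ((n : ℕ) : ℝ) ^ 2) := by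
    intro q
    rw [hΨL]
    exact exists_stdGaussian_abs_mean_sub_ge_le (f := fun u => L (q * u)) (by fun_prop) (hL4 q) hδ
  choose C hC using hdev
  obtain ⟨C', hC'⟩ := exists_stdGaussian_abs_mean_sub_ge_le (f := fun u => u ^ 2) (by fun_prop)
    memLp_sq_gaussianReal hρ
  rw [integral_sq_gaussianReal] at hC'
  have hbound : ∀ n : ℕ+, uniformSphere n {s | ε ≤ |directionalMean L n s t - Ψ t|} ≤
      ENNReal.ofReal (C' / ((n : ℕ) : ℝ) ^ 2) +
        ∑ q ∈ Q, ENNReal.ofReal (C q / ((n : ℕ) : ℝ) ^ 2) := by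
    intro n
    have hn0 : (0 : ℝ) < ((n : ℕ) : ℝ) := by exact_mod_cast n.pos
    have hset : MeasurableSet {x : EuclideanSpace ℝ (Fin (n : ℕ)) |
        ε ≤ |directionalMean L n x t - Ψ t|} := by
      refine measurableSet_le measurable_const ?_
      unfold directionalMean
      fun_prop
    have := uniformSphere_preimage_val n hset
    rw [Set.preimage_ofPred_eq] at this
    rw [this]
    refine le_trans (measure_mono (t := {x | ρ ≤ |((n : ℕ) : ℝ)⁻¹ * ∑ i, (x i) ^ 2 - 1|} ∪
      ⋃ q ∈ Q, {x | δ ≤ |((n : ℕ) : ℝ)⁻¹ * ∑ i, L (q * x i) - Ψ q|}) ?_) ?_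
    · intro x hx
      by_contra hnot
      simp only [Set.mem_union, Set.mem_iUnion, Set.mem_ofPred_eq, not_or, not_exists, not_le]
        at hnot hx
      obtain ⟨hr, hq⟩ := hnot
      obtain ⟨h1, h2⟩ := hρt _ hr
      set r := ((n : ℕ) : ℝ)⁻¹ * ∑ i, (x i) ^ 2 with hrdef
      have hconv : ConvexOn ℝ Set.univ fun s : ℝ => ((n : ℕ) : ℝ)⁻¹ * ∑ i, L (s * x i) := by
        have := convexOn_directionalMean hL n ((√((n : ℕ) : ℝ))⁻¹ • x)
        refine this.congr fun s _ => ?_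
        simp [directionalMean, hn0.ne']
      have h3 := hstab _ hconv (fun q hqQ => hq q hqQ) _ h1
      have hnorm : ‖x‖ = √((n : ℕ) : ℝ) * √r := by
        rw [EuclideanSpace.norm_eq, ← Real.sqrt_mul hn0.le, hrdef, mul_inv_cancel_left₀ hn0.ne']
        simp
      have h4 : directionalMean L n (‖x‖⁻¹ • x) t =
          ((n : ℕ) : ℝ)⁻¹ * ∑ i, L (t / √r * x i) := by
        unfold directionalMean
        congr 1
        refine Finset.sum_congr rfl fun i _ => ?_
        have := Real.sqrt_pos.2 hn0
        have := Real.sqrt_pos.2 h2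
        rw [hnorm]
        simp only [PiLp.smul_apply, smul_eq_mul]
        congr 1
        field_simp
      rw [h4] at hx
      linarith
    · refine (measure_union_le _ _).trans (add_le_add (hC' n) ?_)
      exact (measure_biUnion_finset_le _ _).trans (Finset.sum_le_sum fun q _ => hC q n)
  refine ne_top_of_le_ne_top ?_ (ENNReal.tsum_le_tsum hbound)
  rw [ENNReal.tsum_add, Summable.tsum_finsetSum fun _ _ => ENNReal.summable]
  exact ENNReal.add_ne_top.2 ⟨tsum_ofReal_div_sq_ne_top C',
    ENNReal.sum_ne_top.2 fun q _ => tsum_ofReal_div_sq_ne_top (C q)⟩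

/-- By Borel–Cantelli, which needs no assumption on the joint law of the directions, the empirical
means converge almost surely at rational arguments, and then by convexity at all arguments. -/
theorem ae_forall_tendsto_directionalMean {L : ℝ → ℝ} (hL : ConvexOn ℝ Set.univ L)
    (hL4 : ∀ t, MemLp (fun u => L (t * u)) 4 (gaussianReal 0 1)) {Ψ : ℝ → ℝ} (hΨ : Continuous Ψ)
    (hΨL : ∀ t, Ψ t = ∫ u, L (t * u) ∂(gaussianReal 0 1))
    (σ : Measure Directions) (hσ : ∀ n : ℕ+, σ.map (fun θ => θ n) = uniformSphere n) :
    ∀ᵐ θ ∂σ, ∀ t, Tendsto (fun n : ℕ+ => directionalMean L n (θ n) t) atTop (𝓝 (Ψ t)) := by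
  have hq : ∀ (q : ℚ) (k : ℕ), ∀ᵐ θ ∂σ, ∀ᶠ n : ℕ+ in atTop,
      |directionalMean L n (θ n) q - Ψ q| < 1 / ((k : ℝ) + 1) := by
    intro q k
    have hsum := tsum_uniformSphere_abs_directionalMean_sub_ne_top hL hL4 hΨ hΨL q
      (show 0 < 1 / ((k : ℝ) + 1) by positivity)
    have hsum' : ∑' n : ℕ+, σ {θ | 1 / ((k : ℝ) + 1) ≤ |directionalMean L n (θ n) q - Ψ q|} ≠ ⊤ := by
      refine ne_top_of_le_ne_top hsum (ENNReal.tsum_le_tsum fun n => ?_)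
      rw [← hσ n]
      exact Measure.le_map_apply (measurable_pi_apply n).aemeasurable
        {s : UnitSphere n | 1 / ((k : ℝ) + 1) ≤ |directionalMean L n s q - Ψ q|}
    have hbc := ae_finite_setOfPred_mem hsum'
    filter_upwards [hbc] with θ hθ
    obtain ⟨N, hN⟩ := hθ.bddAbove
    filter_upwards [eventually_gt_atTop N] with n hn
    by_contra! hle
    exact absurd (hN hle) (not_le.2 hn)
  filter_upwards [ae_all_iff.2 fun q => ae_all_iff.2 fun k => hq q k] with θ hθ t
  rw [Metric.tendsto_nhds]
  intro ε hε
  obtain ⟨Q, δ, hδ, hstab⟩ := exists_forall_convexOn_abs_sub_lt hΨ t hε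
  obtain ⟨k, hk⟩ := exists_nat_one_div_lt hδ
  have hev : ∀ᶠ n : ℕ+ in atTop, ∀ q ∈ Q, |directionalMean L n (θ n) q - Ψ q| < δ := by
    rw [eventually_all_finset]
    intro q _
    filter_upwards [hθ q k] with n hn
    exact hn.trans hk
  filter_upwards [hev] with n hn
  rw [Real.dist_eq]
  exact hstab _ (convexOn_directionalMean hL n _) hn t (by simpa using hδ)

/-! ### Cumulant generating functions -/

theorem differentiable_and_convexOn_cgf {Ω : Type*} [MeasurableSpace Ω] {μ : Measure Ω} {Y : Ω → ℝ}
    (h : ∀ t, Integrable (fun ω => Real.exp (t * Y ω)) μ) :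
    Differentiable ℝ (cgf Y μ) ∧ ConvexOn ℝ Set.univ (cgf Y μ) := by
  have hmem : ∀ t, t ∈ interior (integrableExpSet Y μ) := by
    have : integrableExpSet Y μ = Set.univ := Set.eq_univ_of_forall h
    simp [this]
  have han : ∀ t, AnalyticAt ℝ (cgf Y μ) t := fun t => analyticAt_cgf (hmem t)
  have hd : Differentiable ℝ (cgf Y μ) := fun t => (han t).differentiableAt
  refine ⟨hd, convexOn_univ_of_deriv2_nonneg hd (fun t => (han t).deriv.differentiableAt) ?_⟩
  intro t
  rw [← iteratedDeriv_eq_iterate, iteratedDeriv_two_cgf_eq_integral (hmem t)]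
  exact div_nonneg (integral_nonneg fun ω => by positivity) mgf_nonneg

section LogMgf

variable {γ : Measure ℝ} [IsProbabilityMeasure γ]

/-- The logarithmic moment generating function is finite almost everywhere, hence at arguments of
both signs that are arbitrarily large, and exponential moments interpolate. -/
theorem LogMgfFourthMoment.integrable_exp (h : LogMgfFourthMoment γ) (t : ℝ) :
    Integrable (fun x => Real.exp (t * id x)) γ := by
  have hae : ∀ᵐ u ∂(volume : Measure ℝ), logMgf γ u ≠ ⊤ := by
    refine (gaussianReal_absolutelyContinuous' 0 (one_ne_zero (α := NNReal))).ae_le ?_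
    have hm : Measurable fun u => (logMgf γ (1 * u)).abs ^ 4 := by
      have h1 : Measurable fun u => logMgf γ (1 * u) :=
        (Measurable.lintegral_prod_right'
          (f := fun p : ℝ × ℝ => ENNReal.ofReal (Real.exp (1 * p.1 * p.2))) (by fun_prop)).ennreal_log
      exact (EReal.measurable_of_measurable_real (f := EReal.abs) (by
        simp only [EReal.abs_def]; fun_prop)).comp h1 |>.pow_const 4
    filter_upwards [ae_lt_top hm (h 1).ne] with u hu htop
    simp [htop] at hu
  have hdense := Measure.dense_of_ae hae
  have hfin : ∀ u, logMgf γ u ≠ ⊤ → Integrable (fun x => Real.exp (u * id x)) γ := by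
    intro u hu
    refine ⟨by fun_prop, ?_⟩
    rw [hasFiniteIntegral_iff_ofReal (Eventually.of_forall fun x => Real.exp_nonneg _)]
    exact lt_top_iff_ne_top.2 fun htop => hu (ENNReal.log_eq_top_iff.2 htop)
  obtain ⟨a, ha, ha2⟩ := hdense.exists_lt t
  obtain ⟨b, hb, hb2⟩ := hdense.exists_gt t
  exact integrable_exp_mul_of_le_of_le (hfin a ha) (hfin b hb) ha2.le hb2.le

theorem logMgf_eq_cgf (h : ∀ t, Integrable (fun x => Real.exp (t * id x)) γ) (t : ℝ) :
    logMgf γ t = ((cgf id γ t : ℝ) : EReal) := by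
  have h1 := ofReal_integral_eq_lintegral_ofReal (h t)
    (Eventually.of_forall fun x => Real.exp_nonneg _)
  simp only [id] at h1
  rw [logMgf, ← h1]
  refine (ENNReal.log_ofReal_of_pos (mgf_pos (X := id) (h t))).trans ?_
  rfl

theorem LogMgfFourthMoment.memLp_cgf (h : LogMgfFourthMoment γ) (t : ℝ) :
    MemLp (fun u => cgf id γ (t * u)) 4 (gaussianReal 0 1) := by
  have hexp := h.integrable_exp
  have hc := (differentiable_and_convexOn_cgf hexp).1.continuous
  refine memLp_four_of_lintegral_ne_top (by fun_prop) ?_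
  convert (h t).ne using 4 with u
  rw [logMgf_eq_cgf hexp, EReal.abs_def, Real.enorm_eq_ofReal_abs]

end LogMgf

/-! ### Averages of a convex function over dilations -/

section Dilation

variable {L : ℝ → ℝ} {ν : Measure ℝ}

theorem convexOn_integral_dilation (hL : ConvexOn ℝ Set.univ L)
    (hint : ∀ t, Integrable (fun u => L (t * u)) ν) :
    ConvexOn ℝ Set.univ fun t => ∫ u, L (t * u) ∂ν := by
  refine ⟨convex_univ, fun s _ t _ a b ha hb hab => ?_⟩
  simp only [smul_eq_mul]
  rw [← integral_const_mul, ← integral_const_mul,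
    ← integral_add ((hint s).const_mul a) ((hint t).const_mul b)]
  refine integral_mono (hint _) (((hint s).const_mul a).add ((hint t).const_mul b)) fun u => ?_
  have := hL.2 (Set.mem_univ (s * u)) (Set.mem_univ (t * u)) ha hb hab
  simp only [smul_eq_mul] at this
  rwa [show (a * s + b * t) * u = a * (s * u) + b * (t * u) by ring]

/-- The slopes of `s ↦ L (s u)` near `t` lie between difference quotients at integer distance, which
dominates the derivative under the integral. -/
theorem differentiable_integral_dilation (hL : ConvexOn ℝ Set.univ L) (hd : Differentiable ℝ L)
    (hint : ∀ t, Integrable (fun u => L (t * u)) ν) :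
    Differentiable ℝ fun t => ∫ u, L (t * u) ∂ν := by
  intro t
  have hder : ∀ s u : ℝ, HasDerivAt (fun s => L (s * u)) (deriv L (s * u) * u) s := by
    intro s u
    have h1 : HasDerivAt (fun s : ℝ => s * u) u s := by
      simpa using (hasDerivAt_id s).mul_const u
    exact (hd (s * u)).hasDerivAt.comp s h1
  have hcont : Continuous L := hd.continuous
  have hbound : ∀ u, ∀ s ∈ Metric.ball t 1, ‖deriv L (s * u) * u‖ ≤
      |L ((t + 2) * u)| + |L ((t + 1) * u)| + (|L ((t - 1) * u)| + |L ((t - 2) * u)|) := by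
    intro u s hs
    rw [Metric.mem_ball, Real.dist_eq, abs_lt] at hs
    have hconv : ConvexOn ℝ Set.univ fun s => L (s * u) := by
      refine ⟨convex_univ, fun p _ q _ a b ha hb hab => ?_⟩
      have := hL.2 (Set.mem_univ (p * u)) (Set.mem_univ (q * u)) ha hb hab
      simp only [smul_eq_mul] at this ⊢
      rwa [show (a * p + b * q) * u = a * (p * u) + b * (q * u) by ring]
    have hmono : ∀ {p q : ℝ}, p ≤ q → deriv L (p * u) * u ≤ deriv L (q * u) * u := by
      intro p q hpq
      have := (hconv.monotoneOn_deriv fun s _ => (hder s u).differentiableAt)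
        (Set.mem_univ p) (Set.mem_univ q) hpq
      rwa [(hder p u).deriv, (hder q u).deriv] at this
    have hup := hconv.le_slope_of_hasDerivAt (Set.mem_univ (t + 1)) (Set.mem_univ (t + 2))
      (by linarith) (hder (t + 1) u)
    have hlo := hconv.slope_le_of_hasDerivAt (Set.mem_univ (t - 2)) (Set.mem_univ (t - 1))
      (by linarith) (hder (t - 1) u)
    rw [slope_def_field, show t + 2 - (t + 1) = 1 by ring, div_one] at hup
    rw [slope_def_field, show t - 1 - (t - 2) = 1 by ring, div_one] at hlo
    have m1 := hmono (show s ≤ t + 1 by linarith)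
    have m2 := hmono (show t - 1 ≤ s by linarith)
    rw [Real.norm_eq_abs, abs_le]
    constructor
    · linarith [neg_abs_le (L ((t - 1) * u)), le_abs_self (L ((t - 2) * u)),
        abs_nonneg (L ((t + 1) * u)), abs_nonneg (L ((t + 2) * u))]
    · linarith [neg_abs_le (L ((t + 1) * u)), le_abs_self (L ((t + 2) * u)),
        abs_nonneg (L ((t - 1) * u)), abs_nonneg (L ((t - 2) * u))]
  have h := hasDerivAt_integral_of_dominated_loc_of_deriv_le (μ := ν)
    (F := fun s u => L (s * u)) (F' := fun s u => deriv L (s * u) * u)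
    (Metric.ball_mem_nhds t one_pos)
    (Eventually.of_forall fun s => (hint s).aestronglyMeasurable) (hint t)
    (Measurable.aestronglyMeasurable
      (((measurable_deriv L).comp (measurable_const_mul t)).mul measurable_id))
    (Eventually.of_forall hbound)
    ((((hint (t + 2)).abs.add (hint (t + 1)).abs)).add
      ((hint (t - 1)).abs.add (hint (t - 2)).abs))
    (Eventually.of_forall fun u s _ => hder s u)
  exact h.2.differentiableAt

end Dilation

/-! ### Moment generating functions of the weighted means -/

section WeightedMean

theorem weightedMean_eq_sum {Ω : Type*} (X : ℕ → Ω → ℝ) (θ : Directions) (n : ℕ+) :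
    weightedMean X θ n = ∑ i : Fin (n : ℕ),
      fun ω => ((√((n : ℕ) : ℝ))⁻¹ * (θ n : EuclideanSpace ℝ (Fin (n : ℕ))) i) * X i ω := by
  ext ω
  simp only [weightedMean, PiLp.inner_apply, RCLike.inner_apply, conj_trivial, Finset.sum_apply,
    Finset.mul_sum, mul_assoc]

variable {Ω : Type*} [MeasurableSpace Ω] {P : Measure Ω} [IsProbabilityMeasure P]
  {γ : Measure ℝ} {X : ℕ → Ω → ℝ}

theorem measurable_weightedMean (hX : ∀ i, Measurable (X i)) (θ : Directions) (n : ℕ+) :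
    Measurable (weightedMean X θ n) := by
  rw [weightedMean_eq_sum]
  fun_prop

theorem integrable_exp_and_cgf_map_weightedMean (hX : ∀ i, Measurable (X i)) (hind : iIndepFun X P)
    (hlaw : ∀ i, P.map (X i) = γ) (hexp : ∀ t, Integrable (fun x => Real.exp (t * id x)) γ)
    (θ : Directions) (n : ℕ+) (t : ℝ) :
    Integrable (fun x => Real.exp (t * id x)) (P.map (weightedMean X θ n)) ∧
    cgf id (P.map (weightedMean X θ n)) t = ∑ i : Fin (n : ℕ), cgf id γ
      (((√((n : ℕ) : ℝ))⁻¹ * (θ n : EuclideanSpace ℝ (Fin (n : ℕ))) i) * t) := by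
  have hW := measurable_weightedMean hX θ n
  set c : Fin (n : ℕ) → ℝ :=
    fun i => (√((n : ℕ) : ℝ))⁻¹ * (θ n : EuclideanSpace ℝ (Fin (n : ℕ))) i with hc
  set Y : Fin (n : ℕ) → Ω → ℝ := fun i ω => c i * X i ω with hY
  have hYm : ∀ i, Measurable (Y i) := fun i => by fun_prop
  have hYind : iIndepFun Y P :=
    (hind.precomp Fin.val_injective).comp (fun i x => c i * x) fun i => by fun_prop
  have hXexp : ∀ i s, Integrable (fun ω => Real.exp (s * X i ω)) P := by
    intro i s
    have := hexp s
    rw [← hlaw i] at this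
    exact (integrable_map_measure (by fun_prop) (hX i).aemeasurable).1 this
  have hYexp : ∀ i, Integrable (fun ω => Real.exp (t * Y i ω)) P := by
    intro i
    simpa only [hY, mul_assoc] using hXexp i (t * c i)
  have hWY : weightedMean X θ n = ∑ i, Y i := weightedMean_eq_sum X θ n
  constructor
  · rw [integrable_map_measure (by fun_prop) hW.aemeasurable]
    have := hYind.integrable_exp_mul_sum hYm (s := Finset.univ) (t := t) fun i _ => hYexp i
    rwa [← hWY] at this
  · rw [cgf, mgf_id_map hW.aemeasurable, ← cgf, hWY, hYind.cgf_sum hYm fun i _ => hYexp i]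
    refine Finset.sum_congr rfl fun i _ => ?_
    rw [cgf, hY, mgf_const_mul, ← mgf_id_map (hX i).aemeasurable, hlaw, ← cgf]

end WeightedMean

theorem theorem2p1
    {Ω : Type*} [MeasurableSpace Ω] (P : Measure Ω) [IsProbabilityMeasure P]
    (γ : Measure ℝ)
    (X : ℕ → Ω → ℝ)
    (hX_meas : ∀ i, Measurable (X i))
    (hX_indep : iIndepFun X P)
    (hX_law : ∀ i, P.map (X i) = γ)
    (σ : Measure Directions) [IsProbabilityMeasure σ]
    (H1 : ∀ n : ℕ+, σ.map (fun θ => θ n) = uniformSphere n)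
    (H2 : LogMgfFourthMoment γ) :
    ∀ᵐ θ ∂σ,
      SatisfiesLDP (fun n => P.map (weightedMean X θ n)) (legendre (gaussianLogMgf γ)) ∧
      HasCompactLevelSets (legendre (gaussianLogMgf γ)) ∧
      EpigraphConvex (legendre (gaussianLogMgf γ)) := by
  have hγ : IsProbabilityMeasure γ :=
    hX_law 0 ▸ Measure.isProbabilityMeasure_map (hX_meas 0).aemeasurable
  have hexp := H2.integrable_exp
  obtain ⟨hLd, hLc⟩ := differentiable_and_convexOn_cgf hexp
  have hΨ : gaussianLogMgf γ = fun t => ∫ u, cgf id γ (t * u) ∂(gaussianReal 0 1) := by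
    ext t
    simp [gaussianLogMgf, logMgf_eq_cgf hexp]
  have hint : ∀ t, Integrable (fun u => cgf id γ (t * u)) (gaussianReal 0 1) := fun t =>
    (H2.memLp_cgf t).integrable (by norm_num)
  have hconv : ConvexOn ℝ Set.univ (gaussianLogMgf γ) := hΨ ▸ convexOn_integral_dilation hLc hint
  have hdiff : Differentiable ℝ (gaussianLogMgf γ) :=
    hΨ ▸ differentiable_integral_dilation hLc hLd hint
  have h0 : gaussianLogMgf γ 0 = 0 := by simp [hΨ]
  filter_upwards [ae_forall_tendsto_directionalMean hLc H2.memLp_cgf hdiff.continuous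
    (fun t => by rw [hΨ]) σ H1] with θ hθ
  have : ∀ n, IsProbabilityMeasure (P.map (weightedMean X θ n)) := fun n =>
    Measure.isProbabilityMeasure_map (measurable_weightedMean hX_meas θ n).aemeasurable
  have hW := fun n t =>
    integrable_exp_and_cgf_map_weightedMean hX_meas hX_indep hX_law hexp θ n t
  refine ⟨satisfiesLDP_legendre hconv hdiff h0 (fun n t => (hW n t).1) fun t => ?_,
    hasCompactLevelSets_legendre _, epigraphConvex_legendre _⟩
  convert hθ t using 2 with n
  rw [(hW n _).2, directionalMean]
  congr 1
  refine Finset.sum_congr rfl fun i _ => ?_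
  have hn : 0 < √((n : ℕ) : ℝ) := Real.sqrt_pos.2 (by exact_mod_cast n.pos)
  congr 1
  -- The scaling `n / √n = √n` turns the argument `n t` of the mean into `t √n θᵢ`.
  calc _ = (√((n : ℕ) : ℝ))⁻¹ * (θ n : EuclideanSpace ℝ (Fin (n : ℕ))) i *
        ((√((n : ℕ) : ℝ) * √((n : ℕ) : ℝ)) * t) := by
        rw [Real.mul_self_sqrt (by positivity)]
    _ = _ := by field_simp
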